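/- Let $C_0^\infty(\mathbb R^+)$ be the space of smooth complex-valued functions with compact support in $(0,\infty)$. For $h\in C_0^\infty(\mathbb R^+)$, $t\in\mathbb R$ and $\operatorname{Re}\alpha>0$ let $$\mathbb I_\alpha(h)(t)=\frac1{\Gamma(\alpha)}\int_0^t (t-s)^{\alpha-1}h(s)\,ds,$$ and for arbitrary $\alpha\in\mathbb C$ let $\mathbb I_\alpha(h)(t)$ be the value at $\alpha$ of the unique entire function of $\alpha$ that extends this expression (for fixed $h$ and $t$). Then for every $\gamma\in\mathbb R$ there is a constant $C$, depending only on $\gamma$, such that for all $h\in C_0^\infty(\mathbb R^+)$ the function $\mathbb I_{i\gamma}(h)$ belongs to $L^2(\mathbb R^+)$ and $$\|\mathbb I_{i\gamma}(h)\|_{L^2(\mathbb R^+)}\le C\,\|h\|_{L^2(\mathbb R^+)}.$$ -/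

import Mathlib

open scoped Distributions

namespace RiemannLiouville

/-- The open half-line `ℝ⁺ = (0, ∞)`. -/
def halfLine : TopologicalSpace.Opens ℝ := ⟨Set.Ioi 0, isOpen_Ioi⟩

/-- The Riemann-Liouville integral `Γ(α)⁻¹ ∫₀ᵗ (t - s) ^ (α - 1) h(s) ds`, meaningful for
`Re α > 0`. -/
noncomputable def fracIntegral (α : ℂ) (h : 𝓓(halfLine, ℂ)) (t : ℝ) : ℂ :=
  (Complex.Gamma α)⁻¹ * ∫ s in (0 : ℝ)..t, ((t - s : ℝ) : ℂ) ^ (α - 1) * h s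

open Filter in
theorem eventuallyEq_zero_atTop {g : ℝ → ℂ} (hc : HasCompactSupport g) : g =ᶠ[atTop] 0 := by
  have := hasCompactSupport_iff_eventuallyEq.1 hc
  rw [coclosedCompact_eq_cocompact] at this
  exact this.filter_mono atTop_le_cocompact

open MeasureTheory Set Filter Topology Asymptotics in
theorem mellin_aux {g : ℝ → ℂ} (hg : Continuous g) (hc : HasCompactSupport g) {s : ℂ}
    (hs : 0 < s.re) : MellinConvergent g s ∧ DifferentiableAt ℂ (mellin g) s := by
  have h1 : LocallyIntegrableOn g (Ioi 0) := hg.locallyIntegrable.locallyIntegrableOn _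
  have h2 : g =O[atTop] (fun x : ℝ => x ^ (-(s.re + 1))) := by
    have h0 : g =ᶠ[atTop] 0 := eventuallyEq_zero_atTop hc
    exact h0.trans_isBigO (isBigO_zero _ _)
  have h3 : g =O[𝓝[>] 0] (fun x : ℝ => x ^ (-(0 : ℝ))) := by
    simp only [neg_zero, Real.rpow_zero]
    exact (hg.continuousAt.tendsto.mono_left nhdsWithin_le_nhds).isBigO_one ℝ
  exact ⟨mellinConvergent_of_isBigO_rpow h1 h2 (by linarith) h3 hs,
    mellin_differentiableAt_of_isBigO_rpow h1 h2 (by linarith) h3 hs⟩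

open MeasureTheory Set Filter Topology in
theorem mellin_deriv {g : ℝ → ℂ} (hg : ContDiff ℝ 1 g) (hc : HasCompactSupport g) {s : ℂ}
    (hs : 0 < s.re) : mellin (deriv g) (s + 1) = - s * mellin g s := by
  have hs0 : s ≠ 0 := by rintro rfl; simp at hs
  have hg' : Continuous (deriv g) := hg.continuous_deriv le_rfl
  have c1 := (mellin_aux hg' hc.deriv (s := s + 1) (by simp; linarith)).1
  have c2 := (mellin_aux hg.continuous hc hs).1
  simp only [MellinConvergent, smul_eq_mul, add_sub_cancel_right] at c1 c2
  have key := integral_Ioi_mul_deriv_eq_deriv_mul (a := (0 : ℝ)) (a' := (0 : ℂ)) (b' := (0 : ℂ))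
    (u := fun x : ℝ => (x : ℂ) ^ s) (u' := fun x : ℝ => s * (x : ℂ) ^ (s - 1))
    (v := g) (v' := deriv g)
    (fun x hx => by
      have := (hasDerivAt_id (x : ℂ)).cpow_const (c := s) (Or.inl (by simpa using hx))
      simpa using this.comp_ofReal)
    (fun x _ => (hg.differentiable one_ne_zero x).hasDerivAt)
    c1
    (by
      have := c2.const_mul s
      refine this.congr (Eventually.of_forall fun x => ?_)
      simp [mul_assoc])
    (by
      have h1 : Continuous fun x : ℝ => (x : ℂ) ^ s :=
        Complex.continuous_ofReal_cpow_const hs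
      have h2 := (h1.mul hg.continuous).tendsto 0
      have h3 : ((0 : ℝ) : ℂ) ^ s * g 0 = 0 := by simp [hs0]
      rw [← h3]
      exact h2.mono_left nhdsWithin_le_nhds)
    (by
      have h0 : g =ᶠ[atTop] 0 := eventuallyEq_zero_atTop hc
      refine tendsto_const_nhds.congr' ?_
      filter_upwards [h0] with x hx
      simp [hx])
  simp only [mellin, smul_eq_mul, add_sub_cancel_right]
  rw [key, ← MeasureTheory.integral_const_mul]
  simp only [sub_self, zero_sub, ← MeasureTheory.integral_neg]
  congr 1
  ext x
  ring

open Filter Topology in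
/-- The normalized Mellin transform of a smooth compactly supported function is entire. -/
theorem mellin_continuation {g : ℝ → ℂ} (hg : ContDiff ℝ (⊤ : ℕ∞) g) (hc : HasCompactSupport g) :
    ∃ F : ℂ → ℂ, Differentiable ℂ F ∧
      ∀ s : ℂ, 0 < s.re → F s = (Complex.Gamma s)⁻¹ * mellin g s := by
  let E : ℕ → ℂ → ℂ := fun n s =>
    (Complex.Gamma (s + n))⁻¹ * ((-1) ^ n * mellin (deriv^[n] g) (s + n))
  have hgn : ∀ n, ContDiff ℝ (⊤ : ℕ∞) (deriv^[n] g) := fun n => hg.iterate_deriv n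
  have hcn : ∀ n, HasCompactSupport (deriv^[n] g) := by
    intro n
    induction n with
    | zero => exact hc
    | succ n ih => rw [Function.iterate_succ_apply']; exact ih.deriv
  have hstep : ∀ (n : ℕ) (s : ℂ), 0 < s.re + n → E n s = E (n + 1) s := by
    intro n s hs
    have hs' : 0 < (s + n).re := by simpa using hs
    have h0 : s + n ≠ 0 := by intro h; simp [h] at hs'
    have h1 := mellin_deriv ((hgn n).of_le (by exact_mod_cast le_top)) (hcn n) hs'
    simp only [E, Function.iterate_succ_apply', Nat.cast_add, Nat.cast_one, ← add_assoc]
    rw [h1, Complex.Gamma_add_one _ h0, mul_inv]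
    field_simp
    ring
  have hE : ∀ (n m : ℕ) (s : ℂ), 0 < s.re + n → n ≤ m → E n s = E m s := by
    intro n m s hs hnm
    induction m, hnm using Nat.le_induction with
    | base => rfl
    | succ m hm ih =>
      rw [ih]
      have : (n : ℝ) ≤ m := by exact_mod_cast hm
      exact hstep m s (by linarith)
  have hd : ∀ (n : ℕ) (s : ℂ), 0 < s.re + n → DifferentiableAt ℂ (E n) s := by
    intro n s hs
    have hs' : 0 < (s + n).re := by simpa using hs
    have hadd : DifferentiableAt ℂ (fun z : ℂ => z + n) s := by fun_prop
    have h1 : DifferentiableAt ℂ (fun z : ℂ => (Complex.Gamma (z + n))⁻¹) s :=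
      DifferentiableAt.comp (g := fun z : ℂ => (Complex.Gamma z)⁻¹) s
        (Complex.differentiable_one_div_Gamma (s + n)) hadd
    have h2 : DifferentiableAt ℂ (fun z : ℂ => mellin (deriv^[n] g) (z + n)) s :=
      DifferentiableAt.comp (g := mellin (deriv^[n] g)) s
        (mellin_aux (hgn n).continuous (hcn n) hs').2 hadd
    exact h1.mul (h2.const_mul _)
  have hN : ∀ s : ℂ, 0 < s.re + (⌊-s.re⌋₊ + 1 : ℕ) := by
    intro s
    have := Nat.lt_floor_add_one (-s.re)
    push_cast
    linarith
  refine ⟨fun s => E (⌊-s.re⌋₊ + 1) s, ?_, ?_⟩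
  · intro s
    obtain ⟨K, hK⟩ := exists_nat_gt (1 - s.re)
    have hev : ∀ᶠ z : ℂ in 𝓝 s, 1 - z.re < K :=
      (Continuous.tendsto (by fun_prop : Continuous fun z : ℂ => 1 - z.re) s).eventually
        (gt_mem_nhds hK)
    refine (hd K s (by linarith)).congr_of_eventuallyEq ?_
    filter_upwards [hev] with z hz
    rcases le_total (⌊-z.re⌋₊ + 1) K with h | h
    · exact hE _ _ z (hN z) h
    · exact (hE _ _ z (by linarith) h).symm
  · intro s hs
    have := hE 0 (⌊-s.re⌋₊ + 1) s (by simpa using hs) (Nat.zero_le _)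
    simp only [← this]
    simp [E]

open MeasureTheory Set in
theorem fracIntegral_eq_mellin (α : ℂ) (h : 𝓓(halfLine, ℂ)) (t : ℝ) :
    fracIntegral α h t = (Complex.Gamma α)⁻¹ * mellin (fun u => h (t - u)) α := by
  have hz : ∀ s : ℝ, s ≤ 0 → h s = 0 := fun s hs =>
    image_eq_zero_of_notMem_tsupport fun hm => not_lt.2 hs (h.tsupport_subset hm)
  have hsub : (∫ s in (0 : ℝ)..t, ((t - s : ℝ) : ℂ) ^ (α - 1) * h s) =
      ∫ u in (0 : ℝ)..t, (u : ℂ) ^ (α - 1) * h (t - u) := by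
    have := intervalIntegral.integral_comp_sub_left (a := 0) (b := t)
      (fun u : ℝ => (u : ℂ) ^ (α - 1) * h (t - u)) t
    simpa using this
  simp only [fracIntegral, mellin, smul_eq_mul]
  congr 1
  rcases le_total 0 t with ht | ht
  · rw [hsub, intervalIntegral.integral_of_le ht]
    refine (setIntegral_eq_of_subset_of_forall_sdiff_eq_zero measurableSet_Ioi
      Ioc_subset_Ioi_self fun u hu => ?_).symm
    have : t < u := by
      by_contra hcon
      exact hu.2 ⟨hu.1, not_lt.1 hcon⟩
    simp [hz (t - u) (by linarith)]
  · rw [intervalIntegral.integral_of_ge ht, setIntegral_eq_zero_of_forall_eq_zero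
      (fun s hs => by simp [hz s hs.2]), setIntegral_eq_zero_of_forall_eq_zero
      (fun s hs => by simp [hz (t - s) (by have := mem_Ioi.1 hs; linarith)])]
    simp

/-- For fixed `h ∈ C_c^∞(0, ∞)` and `t`, the Riemann-Liouville integral, as a function of `α` in the
half-plane `Re α > 0`, has exactly one extension to an entire function. -/
theorem existsUnique_continuation (h : 𝓓(halfLine, ℂ)) (t : ℝ) :
    ∃! F : ℂ → ℂ, Differentiable ℂ F ∧ ∀ α : ℂ, 0 < α.re → F α = fracIntegral α h t := by
  have hg : ContDiff ℝ (⊤ : ℕ∞) (fun u : ℝ => h (t - u)) :=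
    h.contDiff.comp (contDiff_const.sub contDiff_id)
  have hc : HasCompactSupport (fun u : ℝ => h (t - u)) :=
    h.hasCompactSupport.comp_homeomorph (Homeomorph.subLeft t)
  obtain ⟨F, hF, hFe⟩ := mellin_continuation hg hc
  refine ⟨F, ⟨hF, fun α hα => (hFe α hα).trans (fracIntegral_eq_mellin α h t).symm⟩, ?_⟩
  rintro G ⟨hG, hGe⟩
  refine AnalyticOnNhd.eq_of_eventuallyEq (z₀ := 1)
    (hG.differentiableOn.analyticOnNhd isOpen_univ)
    (hF.differentiableOn.analyticOnNhd isOpen_univ) ?_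
  filter_upwards [(isOpen_lt continuous_const Complex.continuous_re).mem_nhds
    (show (0 : ℝ) < (1 : ℂ).re by simp)] with α hα
  rw [hGe α hα, hFe α hα, fracIntegral_eq_mellin]

/-- The Riemann-Liouville operator `𝕀_α` of arbitrary complex order `α`: for each `t`, the value at
`α` of the entire function extending the Riemann-Liouville integral from `Re α > 0`. -/
noncomputable def operator (α : ℂ) (h : 𝓓(halfLine, ℂ)) (t : ℝ) : ℂ :=
  (existsUnique_continuation h t).choose α

theorem differentiable_operator (h : 𝓓(halfLine, ℂ)) (t : ℝ) :
    Differentiable ℂ fun α => operator α h t :=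
  (existsUnique_continuation h t).choose_spec.1.1

theorem operator_eq_fracIntegral {α : ℂ} (hα : 0 < α.re) (h : 𝓓(halfLine, ℂ)) (t : ℝ) :
    operator α h t = fracIntegral α h t :=
  (existsUnique_continuation h t).choose_spec.1.2 α hα

end RiemannLiouville

namespace RiemannLiouville

/-! On the Fourier side `𝕀_a` is multiplication by `(2πiξ)^(-a)`, which is bounded when `a = iγ`.
The kernel `u^(iγ-1)` is not integrable, so it is regularized twice: order `a` with `Re a > 0` cures
the singularity at `0`, and a factor `exp (-δu)` cures infinity. As the exponential is
multiplicative, `exp (-δt) 𝕀_a h` is exactly the convolution of the damped kernel with `exp (-δs)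
h`. The multiplier becomes `(δ + 2πiξ)^(-a)`, of norm at most `δ^(-Re a) exp (π|Im a|)`, and
Plancherel gives a weighted `L²` bound.

Coupling `δ = Re a = 1/(n+1)` keeps `δ^(-Re a) ≤ 2`. The entire extension is continuous in `α`, so
the damped integrals converge pointwise to `𝕀_{iγ} h`, and Fatou gives `C = 2 exp (π|γ|)`. -/

open MeasureTheory FourierTransform Complex Set

/-! ### Plancherel and Fourier multipliers -/

open SchwartzMap in
/-- Plancherel's identity for the Fourier integral of an integrable function. -/
theorem eLpNorm_fourier_eq {f : ℝ → ℂ} (hf1 : Integrable f) (hf2 : MemLp f 2)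
    (hF : MemLp (𝓕 f) 2) : eLpNorm f 2 = eLpNorm (𝓕 f) 2 := by
  have key : 𝓕 (hf2.toLp f) = hF.toLp (𝓕 f) := by
    -- The `L²` Fourier transform and the Fourier integral agree as tempered distributions, by `∫ (𝓕
    -- g) f = ∫ g (𝓕 f)`, and `L²` embeds injectively there.
    apply LinearMap.ker_eq_bot.1 (Lp.ker_toTemperedDistributionCLM_eq_bot (F := ℂ)
      (μ := (volume : Measure ℝ)) (p := 2))
    change Lp.toTemperedDistribution (𝓕 (hf2.toLp f)) = Lp.toTemperedDistribution (hF.toLp (𝓕 f))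
    rw [← Lp.fourier_toTemperedDistribution_eq]
    ext g
    rw [TemperedDistribution.fourier_apply, Lp.toTemperedDistribution_apply,
      Lp.toTemperedDistribution_apply]
    have h1 : ∫ x, (𝓕 g) x • (hf2.toLp f) x = ∫ x, (𝓕 g) x • f x := by
      refine integral_congr_ae ?_
      filter_upwards [hf2.coeFn_toLp] with x hx
      rw [hx]
    have h2 : ∫ x, g x • (hF.toLp (𝓕 f)) x = ∫ x, g x • 𝓕 f x := by
      refine integral_congr_ae ?_
      filter_upwards [hF.coeFn_toLp] with x hx
      rw [hx]
    rw [h1, h2]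
    have := VectorFourier.integral_fourierIntegral_smul_eq_flip (L := innerₗ ℝ) (f := g) (g := f)
      (μ := volume) (ν := volume) Real.continuous_fourierChar continuous_inner g.integrable hf1
    rw [flip_innerₗ] at this
    exact this
  have hn := Lp.norm_fourier_eq (hf2.toLp f)
  rw [key, Lp.norm_toLp, Lp.norm_toLp] at hn
  exact ((ENNReal.toReal_eq_toReal_iff' hF.eLpNorm_ne_top hf2.eLpNorm_ne_top).1 hn).symm

open ContinuousLinearMap Convolution in
/-- Convolution with an integrable kernel whose Fourier transform is bounded by `M` has norm at most
`M` on `L²`. -/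
theorem eLpNorm_convolution_le {k : ℝ → ℂ} (hk : Integrable k) {M : ℝ}
    (hM : ∀ ξ, ‖𝓕 k ξ‖ ≤ M) (φ : SchwartzMap ℝ ℂ) :
    eLpNorm (k ⋆[mul ℂ ℂ] φ) 2 ≤ ENNReal.ofReal M * eLpNorm φ 2 := by
  have hc : Integrable (k ⋆[mul ℂ ℂ] φ) := hk.integrable_convolution _ φ.integrable
  -- A bounded integrable function is square integrable.
  obtain ⟨B, hB⟩ : ∃ B, ∀ x, ‖φ x‖ ≤ B := ⟨_, φ.toBoundedContinuousFunction.norm_coe_le_norm⟩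
  have hbdd : ∀ x, ‖(k ⋆[mul ℂ ℂ] φ) x‖ ≤ (∫ y, ‖k y‖) * B := by
    intro x
    rw [convolution_def, ← integral_mul_const]
    refine norm_integral_le_of_norm_le (hk.norm.mul_const B) (.of_forall fun y => ?_)
    simpa using mul_le_mul_of_nonneg_left (hB _) (norm_nonneg _)
  have h2 : MemLp (k ⋆[mul ℂ ℂ] φ) 2 := by
    rw [memLp_two_iff_integrable_sq_norm hc.aestronglyMeasurable]
    exact (hc.norm.bdd_mul (c := (∫ y, ‖k y‖) * B) hc.norm.aestronglyMeasurable
      (.of_forall fun x => by simpa using hbdd x)).congr (.of_forall fun x => (sq _).symm)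
  have hF : 𝓕 (k ⋆[mul ℂ ℂ] φ) = fun ξ => 𝓕 k ξ * 𝓕 φ ξ := by
    ext ξ
    rw [Real.fourier_mul_convolution_eq hk φ.integrable, SchwartzMap.fourier_coe]
  have hcont : Continuous (𝓕 k) :=
    VectorFourier.fourierIntegral_continuous Real.continuous_fourierChar continuous_inner hk
  have hle : ∀ᵐ ξ, ‖𝓕 k ξ * 𝓕 φ ξ‖ ≤ M * ‖𝓕 φ ξ‖ := .of_forall fun ξ => by
    rw [norm_mul]
    exact mul_le_mul_of_nonneg_right (hM ξ) (norm_nonneg _)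
  have hFm : MemLp (𝓕 (k ⋆[mul ℂ ℂ] φ)) 2 := by
    rw [hF]
    exact ((𝓕 φ).memLp 2).of_le_mul
      (hcont.mul (𝓕 φ).continuous).aestronglyMeasurable hle
  have hφ : eLpNorm φ 2 = eLpNorm (𝓕 φ : SchwartzMap ℝ ℂ) 2 := by
    have h := (𝓕 φ : SchwartzMap ℝ ℂ).memLp 2 volume
    rw [SchwartzMap.fourier_coe] at h ⊢
    exact eLpNorm_fourier_eq φ.integrable (φ.memLp 2) h
  rw [eLpNorm_fourier_eq hc h2 hFm, hF, hφ]
  exact eLpNorm_le_mul_eLpNorm_of_ae_le_mul hle 2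


/-! ### The Laplace transform of a complex power -/

theorem integrableOn_cpow_mul_exp {a r : ℂ} (ha : 0 < a.re) (hr : 0 < r.re) :
    IntegrableOn (fun t : ℝ => (t : ℂ) ^ (a - 1) * exp (-(r * t))) (Ioi 0) := by
  have h := integrableOn_rpow_mul_exp_neg_mul_rpow (s := a.re - 1) (by linarith) one_pos hr
  refine Integrable.mono' h ?_ ?_
  · refine ContinuousOn.aestronglyMeasurable (fun t ht => ?_) measurableSet_Ioi
    exact ((continuousAt_ofReal_cpow_const _ _ (Or.inr (ne_of_gt ht))).mul
      (by fun_prop)).continuousWithinAt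
  · filter_upwards [ae_restrict_mem measurableSet_Ioi] with t ht
    rw [norm_mul, norm_cpow_eq_rpow_re_of_pos ht, norm_exp]
    simp

/-- Euler's integral for `Γ`, rescaled by a complex number `r` of positive real part. -/
theorem integral_cpow_mul_exp {a r : ℂ} (ha : 0 < a.re) (hr : 0 < r.re) :
    ∫ t : ℝ in Ioi 0, (t : ℂ) ^ (a - 1) * exp (-(r * t)) = (1 / r) ^ a * Gamma a := by
  let U : Set ℂ := {z | 0 < z.re}
  have hU : IsOpen U := isOpen_lt continuous_const continuous_re
  have hd : DifferentiableOn ℂ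
      (fun r : ℂ => ∫ t : ℝ in Ioi 0, (t : ℂ) ^ (a - 1) * exp (-(r * t))) U := by
    intro z hz
    have hz : 0 < z.re := hz
    have hm : ∀ (b w : ℂ), AEStronglyMeasurable (fun t : ℝ => (t : ℂ) ^ b * exp (-(w * t)))
        (volume.restrict (Ioi 0)) := fun b w =>
      ContinuousOn.aestronglyMeasurable (fun t ht =>
        ((continuousAt_ofReal_cpow_const _ _ (Or.inr (ne_of_gt ht))).mul
          (by fun_prop)).continuousWithinAt) measurableSet_Ioi
    refine (hasDerivAt_integral_of_dominated_loc_of_deriv_le (x₀ := z)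
      (F' := fun w t => (t : ℂ) ^ a * (-1) * exp (-(w * t)))
      (bound := fun t => t ^ a.re * Real.exp (-(z.re / 2) * t ^ (1 : ℝ)))
      -- On this neighbourhood of `z` one exponential dominates all the derivatives.
      (s := {w | z.re / 2 < w.re})
      ((isOpen_lt continuous_const continuous_re).mem_nhds (by simpa using half_lt_self hz))
      (.of_forall fun w => hm _ w) (integrableOn_cpow_mul_exp ha hz) ?_ ?_ ?_
      ?_).2.differentiableAt.differentiableWithinAt
    · refine (hm a z).neg.congr (.of_forall fun t => ?_)
      simp
    · filter_upwards [ae_restrict_mem measurableSet_Ioi] with t ht w hw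
      rw [norm_mul, norm_mul, norm_cpow_eq_rpow_re_of_pos ht, norm_exp]
      have ht : 0 < t := ht
      have hw : z.re / 2 < w.re := hw
      simp only [norm_neg, norm_one, mul_one, neg_re, re_mul_ofReal, Real.rpow_one]
      gcongr
      nlinarith
    · exact integrableOn_rpow_mul_exp_neg_mul_rpow (by linarith) one_pos (by linarith)
    · filter_upwards [ae_restrict_mem measurableSet_Ioi] with t ht w hw
      have ht0 : (t : ℂ) ≠ 0 := ofReal_ne_zero.2 (ne_of_gt ht)
      have h1 : HasDerivAt (fun w : ℂ => -(w * t)) (-(1 * (t : ℂ))) w :=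
        ((hasDerivAt_id w).mul_const (t : ℂ)).neg
      refine (h1.cexp.const_mul ((t : ℂ) ^ (a - 1))).congr_deriv ?_
      rw [cpow_sub _ _ ht0, cpow_one]
      field_simp
  have hd' : DifferentiableOn ℂ (fun r : ℂ => (1 / r) ^ a * Gamma a) U := by
    intro z hz
    have hz : 0 < z.re := hz
    have hz0 : z ≠ 0 := by rintro rfl; simp at hz
    have hs : 1 / z ∈ slitPlane := by
      left
      rw [one_div, inv_re]
      exact div_pos hz (normSq_pos.2 hz0)
    have h1 : DifferentiableAt ℂ (fun r : ℂ => 1 / r) z := by fun_prop (disch := exact hz0)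
    exact ((h1.cpow_const hs).mul_const _).differentiableWithinAt
  have hpre : IsPreconnected U := (convex_halfSpace_re_gt 0).isPreconnected
  -- Identity theorem: the formula is known for real `r > 0`, and the points `1 + 1/(n+1)`
  -- accumulate at `1`.
  refine (hd.analyticOnNhd hU).eqOn_of_preconnected_of_frequently_eq (hd'.analyticOnNhd hU) hpre
    (z₀ := 1) (by simp [U]) ?_ hr
  have hseq : Filter.Tendsto (fun n : ℕ => ((1 + 1 / ((n : ℝ) + 1) : ℝ) : ℂ)) Filter.atTop
      (nhdsWithin 1 {1}ᶜ) := by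
    refine tendsto_nhdsWithin_iff.2 ⟨?_, .of_forall fun n => ?_⟩
    · have := (tendsto_one_div_add_atTop_nhds_zero_nat (𝕜 := ℝ)).const_add 1
      rw [add_zero] at this
      exact (continuous_ofReal.tendsto 1).comp this
    · simp only [mem_compl_iff, mem_singleton_iff, ofReal_eq_one]
      have : (0 : ℝ) < 1 / ((n : ℝ) + 1) := by positivity
      linarith
  refine hseq.frequently (Filter.Frequently.of_forall fun n => ?_)
  exact integral_cpow_mul_exp_neg_mul_Ioi ha (by positivity)

/-- The modulus of `z^a` is at most `|z|^(Re a) exp (-arg z · Im a)`; the crude `|arg z| ≤ π`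
suffices. -/
theorem norm_one_div_cpow_le {δ : ℝ} (hδ : 0 < δ) {r a : ℂ} (hr : δ ≤ r.re) (ha : 0 < a.re) :
    ‖(1 / r) ^ a‖ ≤ (1 / δ) ^ a.re * Real.exp (Real.pi * |a.im|) := by
  refine (norm_cpow_le _ _).trans ?_
  rw [div_eq_mul_inv, ← Real.exp_neg]
  have h1 : δ ≤ ‖r‖ := hr.trans (re_le_norm r)
  have h2 : -(arg (1 / r) * a.im) ≤ Real.pi * |a.im| := by
    refine (neg_le_abs _).trans ?_
    rw [abs_mul]
    exact mul_le_mul_of_nonneg_right (abs_arg_le_pi _) (abs_nonneg _)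
  rw [norm_div, norm_one]
  gcongr

/-! ### Damping and the weighted estimate -/

/-- The Riemann-Liouville kernel `u ^ (a - 1) / Γ(a)` on `(0, ∞)`, damped by `exp (-δ u)`. -/
noncomputable def dampedKernel (δ : ℝ) (a : ℂ) : ℝ → ℂ :=
  (Ioi 0).indicator fun u => (Gamma a)⁻¹ * ((u : ℂ) ^ (a - 1) * exp (-(δ * u)))

theorem integrable_dampedKernel {δ : ℝ} (hδ : 0 < δ) {a : ℂ} (ha : 0 < a.re) :
    Integrable (dampedKernel δ a) :=
  (integrable_indicator_iff measurableSet_Ioi).2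
    ((integrableOn_cpow_mul_exp ha (r := δ) (by simpa using hδ)).const_mul _)

/-- This is the Laplace transform formula at `r = δ + 2πiξ`; the factor `1/Γ(a)` cancels. -/
theorem fourier_dampedKernel {δ : ℝ} (hδ : 0 < δ) {a : ℂ} (ha : 0 < a.re) (ξ : ℝ) :
    𝓕 (dampedKernel δ a) ξ = (1 / (δ + 2 * Real.pi * ξ * I)) ^ a := by
  have hG : Gamma a ≠ 0 := Gamma_ne_zero_of_re_pos ha
  have h := integral_cpow_mul_exp (r := δ + 2 * Real.pi * ξ * I) ha (by simpa using hδ)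
  rw [← mul_div_cancel_right₀ (_ ^ a) hG, ← h, div_eq_inv_mul, ← integral_const_mul,
    Real.fourier_eq', ← integral_indicator measurableSet_Ioi]
  refine integral_congr_ae (.of_forall fun u => ?_)
  by_cases hu : u ∈ Ioi (0 : ℝ)
  · simp only [dampedKernel, indicator_of_mem hu, smul_eq_mul]
    have : exp (-((δ + 2 * Real.pi * ξ * I) * u)) =
        exp ((-2 * Real.pi * inner ℝ u ξ : ℝ) * I) * exp (-(δ * u)) := by
      rw [← Complex.exp_add]
      congr 1
      simp
      ring
    rw [this]
    ring
  · simp [dampedKernel, indicator_of_notMem hu]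

/-- The Schwartz function `s ↦ exp (-δ s) h(s)`. -/
noncomputable def damp (δ : ℝ) (h : 𝓓(halfLine, ℂ)) : SchwartzMap ℝ ℂ :=
  HasCompactSupport.toSchwartzMap (f := fun s : ℝ => exp (-(δ * s)) * h s)
    h.hasCompactSupport.mul_left
    (((contDiff_const.mul ofRealCLM.contDiff).neg.cexp).mul h.contDiff)

theorem damp_apply (δ : ℝ) (h : 𝓓(halfLine, ℂ)) (s : ℝ) :
    damp δ h s = exp (-(δ * s)) * h s := rfl

theorem apply_eq_zero_of_nonpos (h : 𝓓(halfLine, ℂ)) {s : ℝ} (hs : s ≤ 0) : h s = 0 :=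
  image_eq_zero_of_notMem_tsupport fun hm => not_lt.2 hs (h.tsupport_subset hm)

theorem eLpNorm_damp_le {δ : ℝ} (hδ : 0 ≤ δ) (h : 𝓓(halfLine, ℂ)) :
    eLpNorm (damp δ h) 2 ≤ eLpNorm h 2 := by
  refine eLpNorm_mono fun s => ?_
  rw [damp_apply, norm_mul, norm_exp]
  rcases le_total s 0 with hs | hs
  · simp [apply_eq_zero_of_nonpos h hs]
  · refine mul_le_of_le_one_left (norm_nonneg _) (Real.exp_le_one_iff.2 ?_)
    simpa using mul_nonneg hδ hs

open Convolution ContinuousLinearMap in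
/-- Damping turns the Riemann-Liouville integral into a convolution with an integrable kernel. -/
theorem convolution_dampedKernel (δ : ℝ) (a : ℂ) (h : 𝓓(halfLine, ℂ)) (t : ℝ) :
    (dampedKernel δ a ⋆[mul ℂ ℂ] damp δ h) t = exp (-(δ * t)) * fracIntegral a h t := by
  rw [fracIntegral_eq_mellin, mellin, convolution_def, ← mul_assoc, ← integral_const_mul,
    ← integral_indicator measurableSet_Ioi]
  refine integral_congr_ae (.of_forall fun u => ?_)
  by_cases hu : u ∈ Ioi (0 : ℝ)
  · simp only [dampedKernel, indicator_of_mem hu, smul_eq_mul, mul_apply', damp_apply]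
    have : exp (-(δ * t)) = exp (-(δ * u)) * exp (-(δ * (t - u : ℝ))) := by
      rw [← Complex.exp_add]
      congr 1
      push_cast
      ring
    rw [this]
    ring
  · simp [dampedKernel, indicator_of_notMem hu]

/-- The weighted `L²` estimate for the Riemann-Liouville integral of order `Re a > 0`. -/
theorem eLpNorm_exp_mul_fracIntegral_le {δ : ℝ} (hδ : 0 < δ) {a : ℂ} (ha : 0 < a.re)
    (h : 𝓓(halfLine, ℂ)) :
    AEStronglyMeasurable (fun t : ℝ => exp (-(δ * t)) * fracIntegral a h t) ∧
    eLpNorm (fun t : ℝ => exp (-(δ * t)) * fracIntegral a h t) 2 ≤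
      ENNReal.ofReal ((1 / δ) ^ a.re * Real.exp (Real.pi * |a.im|)) * eLpNorm h 2 := by
  have hk := integrable_dampedKernel hδ ha
  have he := funext (convolution_dampedKernel δ a h)
  rw [← he]
  refine ⟨(hk.integrable_convolution _ (damp δ h).integrable).aestronglyMeasurable,
    (eLpNorm_convolution_le hk (fun ξ => ?_) _).trans
      (mul_le_mul_right (eLpNorm_damp_le hδ.le h) _)⟩
  rw [fourier_dampedKernel hδ ha]
  exact norm_one_div_cpow_le hδ (by simp) ha

open Filter Topology in
/-- Fatou's lemma along `a = 1 / (n + 1) + iγ`, `δ = 1 / (n + 1)`, where `(1 / δ) ^ Re a ≤ 2`. -/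
theorem eLpNorm_operator_le (γ : ℝ) (h : 𝓓(halfLine, ℂ)) :
    AEStronglyMeasurable (operator (I * γ) h) ∧ eLpNorm (operator (I * γ) h) 2 ≤
      ENNReal.ofReal (2 * Real.exp (Real.pi * |γ|)) * eLpNorm h 2 := by
  let ε : ℕ → ℝ := fun n => 1 / ((n : ℝ) + 1)
  have hε : ∀ n, 0 < ε n := fun n => by positivity
  have hε0 : Tendsto ε atTop (𝓝 0) := tendsto_one_div_add_atTop_nhds_zero_nat
  have hεC : Tendsto (fun n => (ε n : ℂ)) atTop (𝓝 0) := by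
    simpa [Function.comp_def] using (continuous_ofReal.tendsto 0).comp hε0
  let f : ℕ → ℝ → ℂ := fun n t => exp (-(ε n * t)) * fracIntegral (ε n + I * γ) h t
  have hre : ∀ n, 0 < (ε n + I * γ : ℂ).re := fun n => by simpa using hε n
  have hf := fun n => eLpNorm_exp_mul_fracIntegral_le (hε n) (hre n) h
  have hlim : ∀ t, Tendsto (fun n => f n t) atTop (𝓝 (operator (I * γ) h t)) := by
    intro t
    have h1 : Tendsto (fun n => exp (-(ε n * t))) atTop (𝓝 1) := by
      have : Continuous fun z : ℂ => exp (-(z * t)) := by fun_prop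
      simpa [Function.comp_def] using (this.tendsto 0).comp hεC
    have h2 : Tendsto (fun n => operator (ε n + I * γ) h t) atTop (𝓝 (operator (I * γ) h t)) := by
      have := ((differentiable_operator h t).continuous.comp
        (continuous_id.add continuous_const : Continuous fun z : ℂ => z + I * γ)).tendsto 0
      simpa [Function.comp_def] using this.comp hεC
    simpa only [one_mul, f, operator_eq_fracIntegral (hre _)] using h1.mul h2
  refine ⟨aestronglyMeasurable_of_tendsto_ae atTop (fun n => (hf n).1) (.of_forall hlim),
    (Lp.eLpNorm_lim_le_liminf_eLpNorm (fun n => (hf n).1) _ (.of_forall hlim)).trans ?_⟩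
  -- A number eventually below the norms is below one of them, so a bound uniform in `n` suffices.
  refine liminf_le_of_le (by isBoundedDefault) fun b hb => ?_
  obtain ⟨n, hn⟩ := hb.exists
  refine hn.trans ((hf n).2.trans (mul_le_mul_left (ENNReal.ofReal_le_ofReal ?_) _))
  have h3 : (1 / ε n) ^ (ε n + I * γ : ℂ).re ≤ 2 := by
    -- Taking the `(n+1)`-th root gives `(n+1)^(1/(n+1)) ≤ 2`.
    have h4 : ((n : ℝ) + 1) ≤ 2 ^ ((n : ℝ) + 1) := by
      exact_mod_cast (Nat.lt_two_pow_self (n := n + 1)).le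
    have h5 : (ε n + I * γ : ℂ).re = ((n : ℝ) + 1)⁻¹ := by
      rw [add_re, ofReal_re, re_mul_ofReal, I_re, zero_mul, add_zero, ← one_div]
    rw [h5, one_div_one_div]
    exact (Real.rpow_inv_le_iff_of_pos (by positivity) zero_le_two (by positivity)).2 h4
  have h6 : (ε n + I * γ : ℂ).im = γ := by simp
  rw [h6]
  gcongr

end RiemannLiouville

open MeasureTheory in
theorem proposition3p1 (γ : ℝ) :
    ∃ C : NNReal, ∀ h : 𝓓(RiemannLiouville.halfLine, ℂ),
      MemLp (RiemannLiouville.operator (Complex.I * γ) h) 2 (volume.restrict (Set.Ioi (0 : ℝ))) ∧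
      eLpNorm (RiemannLiouville.operator (Complex.I * γ) h) 2 (volume.restrict (Set.Ioi (0 : ℝ))) ≤
        C * eLpNorm h 2 (volume.restrict (Set.Ioi (0 : ℝ))) := by
  refine ⟨Real.toNNReal (2 * Real.exp (Real.pi * |γ|)), fun h => ?_⟩
  obtain ⟨hm, hle⟩ := RiemannLiouville.eLpNorm_operator_le γ h
  have hr : eLpNorm h 2 (volume.restrict (Set.Ioi (0 : ℝ))) = eLpNorm h 2 volume :=
    eLpNorm_restrict_eq_of_support_subset fun s hs => by
      by_contra hs0
      exact hs (RiemannLiouville.apply_eq_zero_of_nonpos h (not_lt.1 hs0))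
  have hb := (eLpNorm_restrict_le (RiemannLiouville.operator (Complex.I * γ) h) 2 volume
    (Set.Ioi 0)).trans hle
  rw [hr]
  refine ⟨⟨hm.restrict, hb.trans_lt (ENNReal.mul_lt_top ENNReal.ofReal_lt_top ?_)⟩, hb⟩
  exact (h.continuous.memLp_of_hasCompactSupport h.hasCompactSupport).eLpNorm_lt_top
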